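/- For a finite simple graph $G$ and a positive integer $k$, a stable $k$-partition of $G$ is a multiset $P=\{V_1,\dots,V_k\}$ of $k$ independent sets of $G$, some possibly empty, that partition $V(G)$. For $v\in V(G)$ let $P-v$ be the multiset $\{V_1\setminus\{v\},\dots,V_k\setminus\{v\}\}$. The Bell $k$-coloring graph $\mathcal{B}_k(G)$ has the stable $k$-partitions of $G$ as its vertices, and two distinct stable $k$-partitions $P,Q$ are adjacent if and only if $P-v=Q-v$ for some $v\in V(G)$. Theorem. Let $T_1$ and $T_2$ be finite trees, and assume that it is not the case that one of them has exactly one vertex and the other exactly two vertices. Then $\mathcal{B}_3(T_1)\cong\mathcal{B}_3(T_2)$ if and only if $T_1\cong T_2$. In particular, $\mathcal{B}_3$ is a complete isomorphism invariant for trees with at least two vertices. -/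

import Mathlib

namespace SimpleGraph

/-- A stable `k`-partition of a graph `G`: a multiset of exactly `k` independent sets, some of
them possibly empty, that partition the vertex set: every vertex lies in exactly one part,
counted with multiplicity. -/
structure IsStablePartition {V : Type*} [DecidableEq V] (G : SimpleGraph V) (k : ℕ)
    (P : Multiset (Finset V)) : Prop where
  card_eq : P.card = k
  indep : ∀ S ∈ P, G.IsIndepSet (S : Set V)
  cover : ∀ v : V, P.countP (fun S => v ∈ S) = 1

/-- The type of stable `k`-partitions of `G`. -/
abbrev StablePartition {V : Type*} [DecidableEq V] (G : SimpleGraph V) (k : ℕ) : Type _ :=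
  {P : Multiset (Finset V) // G.IsStablePartition k P}

/-- `P - v`: the multiset of parts of `P` with the vertex `v` deleted from each of them. -/
def partitionDelete {V : Type*} [DecidableEq V] (P : Multiset (Finset V)) (v : V) :
    Multiset (Finset V) :=
  P.map (fun S => S.erase v)

/-- The Bell `k`-coloring graph of `G`: its vertices are the stable `k`-partitions of `G`, and
two distinct partitions `P`, `Q` are adjacent when `P - v = Q - v` for some vertex `v`. -/
def bellColoringGraph {V : Type*} [DecidableEq V] (G : SimpleGraph V) (k : ℕ) :
    SimpleGraph (G.StablePartition k) where
  Adj P Q := P ≠ Q ∧ ∃ v : V, partitionDelete P.1 v = partitionDelete Q.1 v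
  symm := ⟨fun _ _ h => ⟨h.1.symm, h.2.imp fun _ hv => hv.symm⟩⟩
  loopless := ⟨fun _ h => h.1 rfl⟩

end SimpleGraph

/-! With colours in `ZMod 3`, a proper colouring changes by ±1 along each edge. Orient all edges
from one side of the bipartition to the other: on a tree the signs are arbitrary, and can be
recorded by a vertex set X, the sign saying whether X separates the endpoints. Translating the
colours keeps every sign and negating them reverses every sign, so stable 3-partitions are vertex
sets modulo complementation within either side. A vertex can be recoloured exactly when X is
constant on its neighbourhood, and this toggles its membership in X (`IsTree.exists_isFlipModel`).
For n ≥ 2 vertices there are 2^(n-2) classes, which recovers n; the one-vertex tree gives a single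
class, as does n = 2, hence the exception.

If both sides have at least three vertices, the class of the empty set is the only one of degree at
least n. Its neighbours are the single flips, and two vertices are adjacent in the tree exactly when
their flips have no other common neighbour (`adj_iff_common_neighbor`).

Otherwise all degrees are below n and the tree is a star or has a side {v, w} of size two. For n ≥ 4
stars have all degrees n - 1, while the second kind always has a smaller degree. If v and w have a
and b private neighbours and n ≥ 5, exactly 2^a + 2^b - 1 classes have degree n - 1
(`two_pow_add_two_pow`); with a + b = n - 3 this determines {a, b}, hence the tree. -/

namespace SimpleGraph

/-! ### Potentials and bipartitions of trees. -/

section Potential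

variable {V : Type*} {T : SimpleGraph V}

/-- On a tree every antisymmetric edge weight is the difference of a vertex potential. -/
theorem IsTree.exists_potential {G : Type*} [AddCommGroup G] (hT : T.IsTree) (w : V → V → G)
    (hw : ∀ u v, T.Adj u v → w v u = -w u v) :
    ∃ h : V → G, ∀ u v, T.Adj u v → h v = h u + w u v := by
  classical
  obtain ⟨r⟩ := hT.connected.nonempty
  choose p hp _ using fun v => hT.existsUnique_path r v
  -- The potential of a vertex is the total weight of its path from the root `r`.
  let wt : ∀ {v}, T.Walk r v → G := fun q => (q.darts.map fun d => w d.fst d.snd).sum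
  have wt_concat : ∀ {u v} (q : T.Walk r u) (h : T.Adj u v), wt (q.concat h) = wt q + w u v := by
    intro u v q h
    simp [wt, Walk.darts_concat]
  refine ⟨fun v => wt (p v), fun u v huv => ?_⟩
  by_cases hu : u ∈ (p v).support
  · change wt (p v) = wt (p u) + w u v
    rw [hT.isAcyclic.path_concat (hp u) (hp v) huv hu, wt_concat]
  · have hv := hT.isAcyclic.mem_support_of_ne_mem_support_of_adj_of_isPath (hp u) (hp v) huv hu
    have := hT.isAcyclic.path_concat (hp v) (hp u) huv.symm hv
    simp only [this, wt_concat, hw u v huv, neg_add_cancel_right]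

theorem Connected.eq_of_forall_adj {α : Type*} (hT : T.Connected) {f : V → α}
    (hf : ∀ u v, T.Adj u v → f u = f v) (u v : V) : f u = f v := by
  obtain ⟨p⟩ := hT.preconnected u v
  induction p with
  | nil => rfl
  | cons h _ ih => exact (hf _ _ h).trans ih

/-- `s` is a proper 2-colouring of the vertices. -/
def IsSide (T : SimpleGraph V) (s : V → Bool) : Prop :=
  ∀ u v, T.Adj u v → s v = !(s u)

theorem IsTree.exists_isSide (hT : T.IsTree) : ∃ s, T.IsSide s := by
  obtain ⟨h, hh⟩ := hT.exists_potential (fun _ _ => (1 : ZMod 2)) (fun _ _ _ => by decide)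
  refine ⟨fun v => decide (h v = 0), fun u v huv => ?_⟩
  have := hh u v huv
  simp only [this]
  generalize h u = a
  decide +revert

theorem IsSide.not_adj {s : V → Bool} (hs : T.IsSide s) {u v : V} (h : s u = s v) :
    ¬ T.Adj u v := fun huv => by
  have := hs u v huv
  simp_all

/-- A function that takes equal values on vertices with a common neighbour is constant on each
side of the bipartition. -/
theorem Connected.exists_eq_comp_side {α : Type*} (hT : T.Connected) {s : V → Bool}
    (hs : T.IsSide s) {D : V → α}
    (hD : ∀ z a b, T.Adj z a → T.Adj z b → D a = D b) : ∃ d : Bool → α, ∀ v, D v = d (s v) := by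
  obtain ⟨r⟩ := hT.nonempty
  obtain ⟨b, hb⟩ : ∃ b, ∀ v, T.Adj r v → D v = D b := by
    by_cases h : ∃ b, T.Adj r b
    · obtain ⟨b, hb⟩ := h
      exact ⟨b, fun v hv => hD r v b hv hb⟩
    · push Not at h
      exact ⟨r, fun v hv => absurd hv (h v)⟩
  let d : Bool → α := fun c => if c = s r then D r else D b
  -- The invariant carried along a walk is agreement with `d` at a vertex and at all its neighbours;
  -- agreement at the vertex alone would not propagate.
  have key : ∀ u v, T.Walk u v →
      (D u = d (s u) ∧ ∀ x, T.Adj u x → D x = d (s x)) →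
      (D v = d (s v) ∧ ∀ x, T.Adj v x → D x = d (s x)) := by
    intro u v p
    induction p with
    | nil => exact id
    | @cons u v w h p ih =>
      intro hu
      refine ih ⟨hu.2 v h, fun x hx => ?_⟩
      rw [hD v x u hx h.symm, hu.1, hs v x hx, hs u v h, Bool.not_not]
  refine ⟨d, fun v => ?_⟩
  obtain ⟨p⟩ := hT.preconnected r v
  refine (key r v p ⟨by simp [d], fun x hx => ?_⟩).1
  have := hs r x hx
  simp [d, this, hb x hx]

end Potential

/-- Equal multiplicities make the fibres over each value equinumerous, and fibrewise bijections
glue. This aligns the colour names of two partitions. -/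
theorem _root_.Multiset.exists_perm_of_map_univ_eq {ι α : Type*} [Fintype ι] {f g : ι → α}
    (h : (Finset.univ : Finset ι).val.map f = (Finset.univ : Finset ι).val.map g) :
    ∃ σ : Equiv.Perm ι, ∀ i, g (σ i) = f i := by
  classical
  have hc : ∀ c, Nonempty ({i // f i = c} ≃ {i // g i = c}) := by
    intro c
    have := congrArg (Multiset.count c) h
    rw [Multiset.count_map, Multiset.count_map] at this
    refine ⟨Fintype.equivOfCardEq ?_⟩
    rw [Fintype.card_subtype, Fintype.card_subtype]
    simpa [Finset.card_def, eq_comm] using this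
  exact ⟨Equiv.ofFiberEquiv fun c => (hc c).some, fun i => Equiv.ofFiberEquiv_map _ i⟩

/-! ### Partitions as 3-colourings up to permutation of colours. -/

section ColorClasses

variable {V : Type*} [Fintype V] {T : SimpleGraph V}

/-- The multiset of colour classes of a 3-colouring. -/
def colorClasses (f : V → ZMod 3) : Multiset (Finset V) :=
  (Finset.univ : Finset (ZMod 3)).val.map fun i => Finset.univ.filter fun v => f v = i

theorem isStablePartition_colorClasses [DecidableEq V] {f : V → ZMod 3} (hf : ∀ u v, T.Adj u v → f u ≠ f v) :
    T.IsStablePartition 3 (colorClasses f) where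
  card_eq := by simp [colorClasses]
  indep := by
    intro S hS
    obtain ⟨i, -, rfl⟩ := Multiset.mem_map.1 hS
    intro u hu v hv _ huv
    simp only [Finset.coe_filter, Finset.mem_univ, true_and, Set.mem_ofPred_eq] at hu hv
    exact hf u v huv (hu.trans hv.symm)
  cover v := by
    rw [colorClasses, Multiset.countP_map]
    simp only [Finset.mem_filter, Finset.mem_univ, true_and]
    generalize f v = a
    decide +revert

theorem IsStablePartition.exists_colorClasses_eq [DecidableEq V] {P : Multiset (Finset V)}
    (hP : T.IsStablePartition 3 P) :
    ∃ f : V → ZMod 3, (∀ u v, T.Adj u v → f u ≠ f v) ∧ colorClasses f = P := by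
  obtain ⟨x, y, z, rfl⟩ := Multiset.card_eq_three.1 hP.card_eq
  let c : ZMod 3 → Finset V := ![x, y, z]
  have hc : (Finset.univ : Finset (ZMod 3)).val.map c = {x, y, z} := rfl
  have hex : ∀ v, ∃ i, ∀ j, v ∈ c j ↔ i = j := by
    intro v
    have h := hP.cover v
    rw [← hc, Multiset.countP_map, ← Finset.filter_val, Finset.card_val, Finset.card_eq_one] at h
    obtain ⟨i, hi⟩ := h
    refine ⟨i, fun j => ?_⟩
    have := Finset.ext_iff.1 hi j
    simpa [eq_comm] using this
  choose f hf using hex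
  refine ⟨f, fun u v huv h => ?_, ?_⟩
  · have hm : c (f u) ∈ ({x, y, z} : Multiset (Finset V)) := by
      rw [← hc]
      exact Multiset.mem_map_of_mem _ (Finset.mem_univ (f u))
    exact hP.indep _ hm (by simp [hf]) (by simp [hf, h]) huv.ne huv
  · rw [← hc, colorClasses]
    refine Multiset.map_congr rfl fun i _ => ?_
    ext v
    simp [hf]

theorem colorClasses_perm_comp (σ : Equiv.Perm (ZMod 3)) (f : V → ZMod 3) :
    colorClasses (fun v => σ (f v)) = colorClasses f := by
  rw [colorClasses, colorClasses]
  conv_rhs => rw [← Multiset.map_univ_val_equiv σ.symm, Multiset.map_map]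
  refine Multiset.map_congr rfl fun i _ => ?_
  ext v
  simp [Equiv.eq_symm_apply]

theorem exists_perm_of_partitionDelete_eq [DecidableEq V] {f g : V → ZMod 3} {v : V}
    (h : partitionDelete (colorClasses f) v = partitionDelete (colorClasses g) v) :
    ∃ σ : Equiv.Perm (ZMod 3), ∀ u, u ≠ v → f u = σ (g u) := by
  simp only [partitionDelete, colorClasses, Multiset.map_map] at h
  obtain ⟨σ, hσ⟩ := Multiset.exists_perm_of_map_univ_eq h.symm
  refine ⟨σ, fun u hu => ?_⟩
  have := Finset.ext_iff.1 (hσ (g u)) u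
  simpa [hu] using this

theorem exists_perm_of_colorClasses_eq {f g : V → ZMod 3} (h : colorClasses f = colorClasses g) :
    ∃ σ : Equiv.Perm (ZMod 3), ∀ u, f u = σ (g u) := by
  simp only [colorClasses] at h
  obtain ⟨σ, hσ⟩ := Multiset.exists_perm_of_map_univ_eq h.symm
  refine ⟨σ, fun u => ?_⟩
  have := Finset.ext_iff.1 (hσ (g u)) u
  simpa using this

theorem partitionDelete_colorClasses_eq [DecidableEq V] {f g : V → ZMod 3} {v : V}
    (h : ∀ u, u ≠ v → f u = g u) :
    partitionDelete (colorClasses f) v = partitionDelete (colorClasses g) v := by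
  simp only [partitionDelete, colorClasses, Multiset.map_map]
  refine Multiset.map_congr rfl fun i _ => ?_
  ext u
  by_cases hu : u = v
  · simp [hu]
  · simp [hu, h u hu]

end ColorClasses

/-! ### The flip model of the Bell 3-colouring graph. -/

section FlipModel

variable {V : Type*} {T : SimpleGraph V}

/-- The state `X` with the value at `v` changed. -/
def flipAt [DecidableEq V] (X : V → ZMod 2) (v : V) : V → ZMod 2 :=
  fun u => if u = v then X u + 1 else X u

/-- `X` is constant on the neighbourhood of `v`. -/
def IsConstAround (T : SimpleGraph V) (X : V → ZMod 2) (v : V) : Prop :=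
  ∀ a b, T.Adj v a → T.Adj v b → X a = X b

/-- `π` presents `G` as the graph whose vertices are the subsets of the vertex set of `T`, up to
complementation within either side of the bipartition `s`, and where a vertex may change its
membership when the membership is constant on its neighbourhood. -/
structure IsFlipModel {W : Type*} [DecidableEq V] (T : SimpleGraph V) (G : SimpleGraph W)
    (s : V → Bool) (π : (V → ZMod 2) → W) : Prop where
  surjective : Function.Surjective π
  eq_iff : ∀ X Y, π X = π Y ↔ ∃ d : Bool → ZMod 2, ∀ v, Y v = X v + d (s v)
  adj_iff : ∀ X Y, G.Adj (π X) (π Y) ↔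
    π X ≠ π Y ∧ ∃ v, T.IsConstAround X v ∧ π (flipAt X v) = π Y

/-- The step between the colours of adjacent vertices of the 3-colouring `f`, taken from side
`false` to side `true`, is recorded by whether `X` changes along the edge. -/
def Encodes (T : SimpleGraph V) (s : V → Bool) (f : V → ZMod 3) (X : V → ZMod 2) : Prop :=
  ∀ u v, T.Adj u v → f v = f u + (if s u then -1 else 1) * (if X u = X v then 1 else -1)

theorem Encodes.ne {s : V → Bool} {f : V → ZMod 3} {X : V → ZMod 2} (h : T.Encodes s f X)
    {u v : V} (huv : T.Adj u v) : f u ≠ f v := by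
  rw [h u v huv]
  generalize f u = a
  split_ifs <;> decide +revert

/-- The two steps leave the same vertex `z`, so they carry the same orientation sign and are equal
exactly when X agrees at their ends. -/
theorem Encodes.eq_iff_of_adj {s : V → Bool} {f : V → ZMod 3} {X : V → ZMod 2}
    (h : T.Encodes s f X) {z a b : V} (ha : T.Adj z a) (hb : T.Adj z b) :
    f a = f b ↔ X a = X b := by
  rw [h z a ha, h z b hb]
  generalize f z = c
  generalize X z = x
  generalize X a = y
  generalize X b = t
  generalize s z = q
  decide +revert

theorem IsTree.exists_encodes_of_state (hT : T.IsTree) {s : V → Bool} (hs : T.IsSide s)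
    (X : V → ZMod 2) : ∃ f, T.Encodes s f X := by
  refine hT.exists_potential _ fun u v huv => ?_
  rw [hs u v huv]
  generalize X u = x
  generalize X v = y
  generalize s u = q
  decide +revert

theorem IsTree.exists_encodes_of_coloring (hT : T.IsTree) {s : V → Bool} (hs : T.IsSide s)
    {f : V → ZMod 3} (hf : ∀ u v, T.Adj u v → f u ≠ f v) : ∃ X, T.Encodes s f X := by
  obtain ⟨X, hX⟩ := hT.exists_potential
    (fun u v => if f v = f u + (if s u then -1 else 1) then (0 : ZMod 2) else 1) (by
      intro u v huv
      rw [hs u v huv]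
      have := hf u v huv
      generalize f u = x at *
      generalize f v = y at *
      generalize s u = q
      decide +revert)
  refine ⟨X, fun u v huv => ?_⟩
  have h := hf u v huv
  rw [hX u v huv]
  generalize f u = x at *
  generalize f v = y at *
  generalize s u = q
  generalize X u = r
  decide +revert

/-- Colourings with the same increments differ by a constant on a connected graph, and a translation
only renames colours. -/
theorem Encodes.colorClasses_eq [Fintype V] (hT : T.Connected) {s : V → Bool}
    {f g : V → ZMod 3} {X : V → ZMod 2} (hf : T.Encodes s f X) (hg : T.Encodes s g X) :
    colorClasses f = colorClasses g := by
  obtain ⟨r⟩ := hT.nonempty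
  have hc : ∀ v, g v - f v = g r - f r := fun v =>
    hT.eq_of_forall_adj (f := fun v => g v - f v)
      (fun u v huv => by simp only [hf u v huv, hg u v huv]; abel) v r
  rw [← colorClasses_perm_comp (Equiv.addLeft (g r - f r)) f]
  congr 1
  ext v
  simp [← hc v]

theorem Encodes.add_side [Fintype V] {s : V → Bool} (hs : T.IsSide s) {f : V → ZMod 3}
    {X Y : V → ZMod 2} (hf : T.Encodes s f X) {d : Bool → ZMod 2}
    (hd : ∀ v, Y v = X v + d (s v)) :
    ∃ g, T.Encodes s g Y ∧ colorClasses g = colorClasses f := by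
  -- Equal shifts on both sides keep every step; unequal shifts reverse every step, which negates
  -- the colouring.
  by_cases h : d true = d false
  · have hd' : ∀ v, Y v = X v + d true := fun v => by
      rw [hd]
      cases s v <;> simp [h]
    refine ⟨f, fun u v huv => ?_, rfl⟩
    rw [hf u v huv, hd' u, hd' v]
    simp
  · refine ⟨fun v => -f v, fun u v huv => ?_, colorClasses_perm_comp (Equiv.neg _) f⟩
    simp only [hf u v huv, hd u, hd v, hs u v huv]
    generalize f u = x
    generalize X u = y
    generalize X v = z
    generalize s u = q
    clear hd hf
    cases q <;> simp only [Bool.not_true, Bool.not_false, if_true] <;>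
      (generalize d true = d1 at *; generalize d false = d2 at *; decide +revert)

/-- For two vertices with a common neighbour, lying in the same part is equivalent to X agreeing on
them. Hence Y - X agrees on such pairs and depends only on the side. -/
theorem Encodes.exists_add_side [Fintype V] (hT : T.Connected) {s : V → Bool} (hs : T.IsSide s)
    {f g : V → ZMod 3} {X Y : V → ZMod 2} (hf : T.Encodes s f X) (hg : T.Encodes s g Y)
    (h : colorClasses f = colorClasses g) : ∃ d : Bool → ZMod 2, ∀ v, Y v = X v + d (s v) := by
  obtain ⟨σ, hσ⟩ := exists_perm_of_colorClasses_eq h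
  obtain ⟨d, hd⟩ := hT.exists_eq_comp_side hs (D := fun v => Y v - X v) (by
    intro z a b ha hb
    have h1 := hf.eq_iff_of_adj ha hb
    have h2 := hg.eq_iff_of_adj ha hb
    rw [hσ, hσ, σ.injective.eq_iff, h2] at h1
    clear h2
    change Y a - X a = Y b - X b
    generalize Y a = a1 at *
    generalize Y b = a2 at *
    generalize X a = a3 at *
    generalize X b = a4 at *
    decide +revert)
  exact ⟨d, fun v => by rw [← hd v]; abel⟩

/-- Recolouring a vertex with the third colour. -/
theorem Encodes.flipAt_of_recolor [DecidableEq V] {s : V → Bool}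
    {f g : V → ZMod 3} {X : V → ZMod 2} {v : V} (hf : T.Encodes s f X)
    (hg : ∀ a b, T.Adj a b → g a ≠ g b) (hfg : ∀ u, u ≠ v → f u = g u) (hv : f v ≠ g v) :
    T.Encodes s g (flipAt X v) := by
  intro a b hab
  have h1 := hf a b hab
  have h2 := hg a b hab
  have h3 := hf.ne hab
  simp only [flipAt]
  by_cases ha : a = v
  · subst ha
    have hb : b ≠ a := hab.ne'
    rw [← hfg b hb] at h2 ⊢
    simp only [hb, if_true, if_false]
    generalize f a = a1 at *
    generalize f b = a2 at *
    generalize g a = a3 at *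
    generalize X a = a4 at *
    generalize X b = a5 at *
    generalize s a = q at *
    clear hfg hg hf
    decide +revert
  · rw [← hfg a ha] at h2 ⊢
    by_cases hb : b = v
    · subst hb
      simp only [ha, if_true, if_false]
      generalize f a = a1 at *
      generalize f b = a2 at *
      generalize g b = a3 at *
      generalize X a = a4 at *
      generalize X b = a5 at *
      generalize s a = q at *
      clear hfg hg hf
      decide +revert
    · simpa [ha, hb, ← hfg b hb] using h1

theorem IsTree.exists_isFlipModel [Fintype V] [DecidableEq V] (hT : T.IsTree) {s : V → Bool}
    (hs : T.IsSide s) : ∃ π, IsFlipModel T (T.bellColoringGraph 3) s π := by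
  choose F hF using hT.exists_encodes_of_state hs
  have hC := hT.connected
  have key : ∀ {f X}, T.Encodes s f X → colorClasses f = colorClasses (F X) :=
    fun h => h.colorClasses_eq hC (hF _)
  refine ⟨fun X => ⟨colorClasses (F X),
    isStablePartition_colorClasses fun u v huv => (hF X).ne huv⟩, ?_, fun X Y => ?_, fun X Y => ?_⟩
  · rintro ⟨P, hP⟩
    obtain ⟨f, hf, rfl⟩ := hP.exists_colorClasses_eq
    obtain ⟨X, hX⟩ := hT.exists_encodes_of_coloring hs hf
    exact ⟨X, Subtype.ext (key hX).symm⟩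
  · rw [Subtype.mk.injEq]
    refine ⟨(hF X).exists_add_side hC hs (hF Y), ?_⟩
    rintro ⟨d, hd⟩
    obtain ⟨g, hg, h⟩ := (hF X).add_side hs hd
    rw [← h, key hg]
  · refine and_congr_right fun hne => ?_
    simp only [Subtype.mk.injEq, ne_eq] at hne ⊢
    constructor
    · rintro ⟨v, hv⟩
      obtain ⟨σ, hσ⟩ := exists_perm_of_partitionDelete_eq hv
      -- After aligning colours by `σ` the colourings agree off `v`; agreement at `v` too would make
      -- the partitions equal.
      have hv' : F X v ≠ σ (F Y v) := by
        intro h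
        refine hne ?_
        rw [← colorClasses_perm_comp σ (F Y)]
        congr 1
        ext u
        by_cases hu : u = v
        · rw [hu, h]
        · rw [hσ u hu]
      have hprop : ∀ a b, T.Adj a b → σ (F Y a) ≠ σ (F Y b) := fun a b hab h =>
        (hF Y).ne hab (σ.injective h)
      refine ⟨v, fun a b ha hb => ?_, ?_⟩
      · rw [← (hF X).eq_iff_of_adj ha hb]
        have a1 := (hF X).ne ha
        have b1 := (hF X).ne hb
        have a2 := hprop v a ha
        have b2 := hprop v b hb
        rw [← hσ a ha.ne'] at a2
        rw [← hσ b hb.ne'] at b2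
        generalize F X v = x1 at *
        generalize F X a = x2 at *
        generalize F X b = x3 at *
        generalize σ (F Y v) = x4 at *
        clear hσ hprop hne hv key hF
        decide +revert
      · rw [← colorClasses_perm_comp σ (F Y)]
        exact (key ((hF X).flipAt_of_recolor hprop hσ hv')).symm
    · rintro ⟨v, hv, h⟩
      refine ⟨v, ?_⟩
      -- The neighbours of `v` share one colour, so `c` is the colour that is neither theirs nor
      -- that of `v`; with no neighbours any other colour will do.
      obtain ⟨c, hc, hcv⟩ : ∃ c, (∀ a, T.Adj v a → F X a ≠ c) ∧ F X v ≠ c := by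
        by_cases hn : ∃ b, T.Adj v b
        · obtain ⟨b, hb⟩ := hn
          have hb' := (hF X).ne hb
          have : ∀ x y : ZMod 3, x ≠ y → ∃ c, y ≠ c ∧ x ≠ c := by decide
          obtain ⟨c, h1, h2⟩ := this _ _ hb'
          refine ⟨c, fun a ha => ?_, h2⟩
          rwa [((hF X).eq_iff_of_adj ha hb).2 (hv a b ha hb)]
        · push Not at hn
          exact ⟨F X v + 1, fun a ha => absurd ha (hn a), by simp⟩
      have hupd : ∀ u, u ≠ v → F X u = Function.update (F X) v c u := fun u hu => by simp [hu]
      have hg : T.Encodes s (Function.update (F X) v c) (flipAt X v) := by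
        refine (hF X).flipAt_of_recolor (fun a b hab => ?_) hupd (by simpa using hcv)
        by_cases ha : a = v
        · subst ha
          simpa [hab.ne'] using (hc b hab).symm
        · by_cases hb : b = v
          · subst hb
            simpa [ha] using hc a hab.symm
          · simpa [ha, hb] using (hF X).ne hab
      rw [← h, ← key hg]
      exact partitionDelete_colorClasses_eq hupd

end FlipModel

/-! ### Connected graphs with at least two vertices. -/

section Connected

variable {V : Type*} {T : SimpleGraph V} {s : V → Bool}

theorem Connected.exists_adj_of_nontrivial [Nontrivial V] (hT : T.Connected) (v : V) :
    ∃ u, T.Adj v u := by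
  by_contra! h
  obtain ⟨u, hu⟩ := exists_ne v
  have := hT.eq_of_forall_adj (f := fun x => x = v) (fun a b hab => by
    refine propext ⟨?_, ?_⟩
    · rintro rfl
      exact absurd hab (h b)
    · rintro rfl
      exact absurd hab.symm (h a)) u v
  simp [hu] at this

theorem Connected.isSide_surjective [Nontrivial V] (hT : T.Connected) (hs : T.IsSide s) :
    Function.Surjective s := by
  obtain ⟨r⟩ := hT.nonempty
  obtain ⟨u, hu⟩ := hT.exists_adj_of_nontrivial r
  have := hs r u hu
  intro c
  by_cases h : s r = c
  · exact ⟨r, h⟩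
  · refine ⟨u, ?_⟩
    rw [this]
    cases c <;> simpa using h

theorem isConstAround_zero (v : V) : T.IsConstAround 0 v := fun _ _ _ _ => rfl

end Connected

/-! ### Counting classes and degrees in the flip model. -/

section ModelLemmas

variable {V W : Type*} [DecidableEq V] {T : SimpleGraph V} {G : SimpleGraph W}
  {s : V → Bool} {π : (V → ZMod 2) → W}

theorem flipAt_apply (X : V → ZMod 2) (v u : V) :
    flipAt X v u = X u + if u = v then 1 else 0 := by
  simp only [flipAt]
  split_ifs <;> simp

namespace IsFlipModel

theorem finite [Finite V] (hM : IsFlipModel T G s π) : Finite W :=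
  Finite.of_surjective π hM.surjective

/-- Since both sides are inhabited, the four pairs of complementations act freely on states, and the
classes are the orbits. -/
theorem four_mul_card [Fintype V] (hM : IsFlipModel T G s π) (hs : Function.Surjective s) :
    4 * Nat.card W = 2 ^ Fintype.card V := by
  let F : W × (Bool → ZMod 2) → (V → ZMod 2) :=
    fun p v => Function.surjInv hM.surjective p.1 v + p.2 (s v)
  have hF : ∀ p, π (F p) = p.1 := fun p => by
    conv_rhs => rw [← Function.surjInv_eq hM.surjective p.1]
    exact ((hM.eq_iff _ _).2 ⟨p.2, fun _ => rfl⟩).symm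
  have hb : Function.Bijective F := by
    constructor
    · intro p q h
      have h1 : p.1 = q.1 := by rw [← hF p, ← hF q, h]
      refine Prod.ext h1 (funext fun c => ?_)
      obtain ⟨v, rfl⟩ := hs c
      have := congrFun h v
      simpa [F, h1] using this
    · intro X
      obtain ⟨d, hd⟩ := (hM.eq_iff (Function.surjInv hM.surjective (π X)) X).1
        (Function.surjInv_eq _ _)
      exact ⟨(π X, d), funext fun v => (hd v).symm⟩
  have := Nat.card_congr (Equiv.ofBijective F hb)
  simp only [Nat.card_prod, Nat.card_eq_fintype_card, Fintype.card_fun, ZMod.card,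
    Fintype.card_bool] at this
  omega

theorem natCard_eq_one [Subsingleton V] [Nonempty V] (hM : IsFlipModel T G s π) :
    Nat.card W = 1 := by
  rw [Nat.card_eq_one_iff_unique]
  refine ⟨⟨fun a b => ?_⟩, ⟨π 0⟩⟩
  obtain ⟨X, rfl⟩ := hM.surjective a
  obtain ⟨Y, rfl⟩ := hM.surjective b
  obtain ⟨r⟩ := ‹Nonempty V›
  refine (hM.eq_iff _ _).2 ⟨fun _ => Y r - X r, fun v => ?_⟩
  rw [Subsingleton.elim v r, add_sub_cancel]

/-- A third vertex on the side of `x` or `y` is untouched by both flips, which forces the shift on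
that side to vanish; but the flip there needs a nonzero shift. -/
theorem pair_of_flip_eq (hM : IsFlipModel T G s π) {X : V → ZMod 2} {x y : V} (hxy : x ≠ y)
    (h : π (flipAt X x) = π (flipAt X y)) {z : V} (hz : s z = s x ∨ s z = s y) :
    z = x ∨ z = y := by
  obtain ⟨d, hd⟩ := (hM.eq_iff _ _).1 h
  have hx := hd x
  have hy := hd y
  have hz' := hd z
  by_contra! hzn
  simp only [flipAt, if_true, hxy, hxy.symm, hzn.1, hzn.2, if_false] at hx hy hz'
  have hdz : d (s z) = 0 := by simpa using hz'
  rcases hz with hz | hz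
  · rw [← hz, hdz] at hx
    simp at hx
  · rw [← hz, hdz] at hy
    simp at hy

theorem flip_ne (hM : IsFlipModel T G s π) {X : V → ZMod 2} {x z : V} (hz : s z = s x)
    (hzx : z ≠ x) : π (flipAt X x) ≠ π X := by
  intro h
  obtain ⟨d, hd⟩ := (hM.eq_iff _ _).1 h
  have hx := hd x
  have hz' := hd z
  simp only [flipAt, if_true, hzx, if_false] at hx hz'
  have hdz : d (s z) = 0 := by simpa using hz'
  rw [← hz, hdz] at hx
  simp at hx

theorem flip_eq_of_pair (hM : IsFlipModel T G s π) (X : V → ZMod 2) {x y : V} (hxy : x ≠ y)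
    (h : ∀ z, s z = s x ↔ z = x ∨ z = y) : π (flipAt X x) = π (flipAt X y) := by
  refine (hM.eq_iff _ _).2 ⟨fun b => if b = s x then 1 else 0, fun v => ?_⟩
  simp only [h, flipAt]
  have : (1 : ZMod 2) + 1 = 0 := by decide
  by_cases hx : v = x
  · subst hx
    simp [hxy, add_assoc, this]
  · by_cases hy : v = y <;> simp [hx, hy, hxy.symm]

theorem flip_eq_self (hM : IsFlipModel T G s π) (X : V → ZMod 2) {x : V}
    (h : ∀ z, s z = s x ↔ z = x) : π (flipAt X x) = π X := by
  refine (hM.eq_iff _ _).2 ⟨fun b => if b = s x then 1 else 0, fun v => ?_⟩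
  simp only [h, flipAt]
  have : (1 : ZMod 2) + 1 = 0 := by decide
  by_cases hx : v = x <;> simp [hx, add_assoc, this]

theorem card_le_ncard_neighborSet [Finite V] (hM : IsFlipModel T G s π) {X : V → ZMod 2}
    (S : Finset V) (hmono : ∀ x ∈ S, T.IsConstAround X x)
    (hne : ∀ x ∈ S, π (flipAt X x) ≠ π X)
    (hinj : ∀ x ∈ S, ∀ y ∈ S, π (flipAt X x) = π (flipAt X y) → x = y) :
    S.card ≤ (G.neighborSet (π X)).ncard := by
  have := hM.finite
  rw [← Set.ncard_coe_finset S]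
  refine Set.ncard_le_ncard_of_injOn (fun x => π (flipAt X x)) (fun x hx => ?_)
    (fun x hx y hy h => hinj x hx y hy h)
  exact (hM.adj_iff _ _).2 ⟨(hne x hx).symm, x, hmono x hx, rfl⟩

/-- `R` need only represent the flips that are permitted and change the class; degree bounds come
from discarding redundant or frozen vertices. -/
theorem ncard_neighborSet_le (hM : IsFlipModel T G s π) {X : V → ZMod 2}
    (R : Finset V) (h : ∀ x, T.IsConstAround X x →
      π (flipAt X x) = π X ∨ ∃ r ∈ R, π (flipAt X r) = π (flipAt X x)) :
    (G.neighborSet (π X)).ncard ≤ R.card := by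
  classical
  have hsub : G.neighborSet (π X) ⊆ (R.image fun r => π (flipAt X r) : Finset W) := by
    intro w hw
    obtain ⟨Y, rfl⟩ := hM.surjective w
    obtain ⟨hne, x, hx, hxY⟩ := (hM.adj_iff _ _).1 hw
    rw [← hxY] at hne ⊢
    rcases h x hx with h | ⟨r, hr, h⟩
    · exact absurd h.symm hne
    · rw [← h]
      simpa using ⟨r, hr, rfl⟩
  refine (Set.ncard_le_ncard hsub (Finset.finite_toSet _)).trans ?_
  rw [Set.ncard_coe_finset]
  exact Finset.card_image_le

theorem eq_zero_of_isConstAround (hM : IsFlipModel T G s π) (hT : T.Connected)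
    (hs : T.IsSide s) {X : V → ZMod 2} (h : ∀ v, T.IsConstAround X v) : π X = π 0 := by
  obtain ⟨d, hd⟩ := hT.exists_eq_comp_side hs (D := X) h
  refine (hM.eq_iff _ _).2 ⟨d, fun v => ?_⟩
  rw [hd v, CharTwo.add_self_eq_zero]
  rfl

end IsFlipModel

theorem Iso.ncard_neighborSet {W' : Type*} {G' : SimpleGraph W'} (φ : G ≃g G') (w : W) :
    (G'.neighborSet (φ w)).ncard = (G.neighborSet w).ncard :=
  (Nat.card_congr (φ.mapNeighborSet w)).symm

/-- Both sides of the bipartition have at least three elements. -/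
def BigSides (s : V → Bool) : Prop :=
  ∀ c x y, ∃ z, s z = c ∧ z ≠ x ∧ z ≠ y

namespace IsFlipModel

theorem flip_injective (hM : IsFlipModel T G s π) (hb : BigSides s) (X : V → ZMod 2) :
    Function.Injective fun x => π (flipAt X x) := by
  intro x y h
  by_contra hxy
  obtain ⟨z, hz, hzx, hzy⟩ := hb (s x) x y
  rcases hM.pair_of_flip_eq hxy h (Or.inl hz) with h | h
  · exact hzx h
  · exact hzy h

theorem flip_ne_of_bigSides (hM : IsFlipModel T G s π) (hb : BigSides s) (X : V → ZMod 2) (x : V) :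
    π (flipAt X x) ≠ π X := by
  obtain ⟨z, hz, hzx, -⟩ := hb (s x) x x
  exact hM.flip_ne hz hzx

theorem card_le_ncard_neighborSet_zero [Fintype V] (hM : IsFlipModel T G s π) (hb : BigSides s) :
    Fintype.card V ≤ (G.neighborSet (π 0)).ncard :=
  hM.card_le_ncard_neighborSet Finset.univ (fun x _ => isConstAround_zero x)
    (fun x _ => hM.flip_ne_of_bigSides hb 0 x) (fun _ _ _ _ h => hM.flip_injective hb 0 h)

/-- So many neighbours require every vertex to be free to flip, so X is constant on each side. -/
theorem eq_zero_of_card_le [Fintype V] (hM : IsFlipModel T G s π) (hT : T.Connected)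
    (hs : T.IsSide s) {w : W} (hw : Fintype.card V ≤ (G.neighborSet w).ncard) : w = π 0 := by
  classical
  obtain ⟨X, rfl⟩ := hM.surjective w
  refine hM.eq_zero_of_isConstAround hT hs ?_
  have := hw.trans (hM.ncard_neighborSet_le (Finset.univ.filter fun x => T.IsConstAround X x)
    fun x hx => Or.inr ⟨x, by simpa using hx, rfl⟩)
  have h := (Finset.card_eq_iff_eq_univ _).1 (le_antisymm (Finset.card_le_univ _) this)
  intro v
  have := Finset.ext_iff.1 h v
  simpa using this

theorem adj_iff_common_neighbor (hM : IsFlipModel T G s π) (hT : T.Connected) (hs : T.IsSide s)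
    (hb : BigSides s) {x y : V} (hxy : x ≠ y) :
    T.Adj x y ↔ ∀ Q, G.Adj Q (π (flipAt 0 x)) → G.Adj Q (π (flipAt 0 y)) → Q = π 0 := by
  have two : (1 : ZMod 2) + 1 = 0 := by decide
  constructor
  · intro hadj Q h1 h2
    obtain ⟨Y, rfl⟩ := hM.surjective Q
    obtain ⟨-, z, hz, hzQ⟩ := (hM.adj_iff _ _).1 h1.symm
    obtain ⟨-, t, ht, htQ⟩ := (hM.adj_iff _ _).1 h2.symm
    have hsxy := hs x y hadj
    -- Flipping `x` again returns to the zero state; every other route must lead to a contradiction.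
    by_cases hzx : z = x
    · rw [← hzQ, hzx]
      congr 1
      ext v
      by_cases hv : v = x <;> simp [flipAt, hv, two]
    exfalso
    obtain ⟨d, hd⟩ := (hM.eq_iff _ _).1 (hzQ.trans htQ.symm)
    simp only [flipAt_apply, Pi.zero_apply, zero_add] at hd
    have hside : ∀ {u v}, s u ≠ s v → u ≠ v := fun h h' => h (congrArg s h')
    have hyx : s y ≠ s x := by simp [hsxy]
    have hdy := hd y
    have hdx := hd x
    -- A vertex of each side outside the flipped ones shows that no complementation is involved, so
    -- {x, z} = {y, t} literally.
    obtain ⟨hzy, htx⟩ : z = y ∧ t = x := by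
      by_cases hsz : s z = s x
      · have hyz : y ≠ z := hside (by rwa [hsz])
        obtain ⟨p, hp, hpy, hpt⟩ := hb (s y) y t
        have hdp := hd p
        simp only [hpy, hpt, hp, hside (hp ▸ hyx : s p ≠ s x),
          hside (hp.trans_ne (hsz ▸ hyx) : s p ≠ s z), if_false, add_zero, zero_add] at hdp
        simp only [hxy.symm, hyz, ← hdp, if_true, if_false, add_zero] at hdy
        have hty : y = t := by
          by_contra h
          simp [h] at hdy
        subst hty
        obtain ⟨q, hq, hqx, hqz⟩ := hb (s x) x z
        have hdq := hd q
        simp only [hqx, hqz, hq, hside (hq.trans_ne hyx.symm), if_false, add_zero, zero_add] at hdq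
        simp [hxy, Ne.symm hzx, ← hdq] at hdx
      · obtain ⟨q, hq, hqx, hqt⟩ := hb (s x) x t
        have hdq := hd q
        simp only [hqx, hqt, hq, hside (hq.trans_ne hyx.symm), hside (hq.trans_ne (Ne.symm hsz)),
          if_false, add_zero, zero_add] at hdq
        have htx : t = x := by
          by_contra h
          simp [hxy, Ne.symm h, Ne.symm hzx, ← hdq] at hdx
        subst htx
        obtain ⟨p, hp, hpy, hpz⟩ := hb (s y) y z
        have hdp := hd p
        simp only [hpy, hpz, hp, hside (hp.trans_ne hyx), if_false, add_zero, zero_add] at hdp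
        refine ⟨?_, rfl⟩
        by_contra h
        simp [hxy.symm, Ne.symm h, ← hdp] at hdy
    subst hzy htx
    -- Flipping one end of the edge first leaves the other end free only if that edge is its sole
    -- one. Both ends are then leaves, so the edge would be the whole tree.
    have hN1 : ∀ a, T.Adj z a → a = t := by
      intro a ha
      by_contra hat
      have := hz a t ha hadj.symm
      simp [flipAt, hat] at this
    have hN2 : ∀ a, T.Adj t a → a = z := by
      intro a ha
      by_contra hat
      have := ht a z ha hadj
      simp [flipAt, hat] at this
    obtain ⟨p, -, hp1, hp2⟩ := hb true z t
    have := hT.eq_of_forall_adj (f := fun v => v = z ∨ v = t) (fun a b hab => by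
      refine propext ⟨?_, ?_⟩
      · rintro (rfl | rfl)
        · exact Or.inr (hN1 b hab)
        · exact Or.inl (hN2 b hab)
      · rintro (rfl | rfl)
        · exact Or.inr (hN1 a hab.symm)
        · exact Or.inl (hN2 a hab.symm)) p z
    simp [hp1, hp2] at this
  · intro h
    by_contra hadj
    -- For nonadjacent vertices the two flips do not obstruct each other, and the double flip is a
    -- second common neighbour.
    have hne : π (flipAt (flipAt 0 x) y) ≠ π 0 := by
      intro h
      obtain ⟨d, hd⟩ := (hM.eq_iff _ _).1 h
      obtain ⟨p, hp, hpx, hpy⟩ := hb (s x) x y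
      have h1 := hd x
      have h2 := hd p
      rw [hp] at h2
      simp only [flipAt, Pi.zero_apply, hpx, hpy, hxy, if_true, if_false, zero_add] at h1 h2
      rw [← h2] at h1
      simp at h1
    have hcomm : flipAt (flipAt (0 : V → ZMod 2) x) y = flipAt (flipAt 0 y) x := by
      ext v
      simp only [flipAt]
      split_ifs <;> rfl
    have hconst : ∀ {a b : V}, ¬ T.Adj a b → T.IsConstAround (flipAt 0 b) a := by
      intro a b hab p q hp hq
      have h1 : p ≠ b := by rintro rfl; exact hab hp
      have h2 : q ≠ b := by rintro rfl; exact hab hq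
      simp [flipAt, h1, h2]
    refine hne (h _ ?_ ?_)
    · exact ((hM.adj_iff _ _).2 ⟨(hM.flip_ne_of_bigSides hb _ _).symm, y,
        hconst fun h => hadj h.symm, rfl⟩).symm
    · rw [hcomm]
      exact ((hM.adj_iff _ _).2 ⟨(hM.flip_ne_of_bigSides hb _ _).symm, x,
        hconst hadj, rfl⟩).symm

end IsFlipModel

end ModelLemmas

/-! ### Reconstruction when both sides are big. -/

section Reconstruction

variable {V₁ V₂ W₁ W₂ : Type*} [Fintype V₁] [Fintype V₂] [DecidableEq V₁] [DecidableEq V₂]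
  {T₁ : SimpleGraph V₁} {T₂ : SimpleGraph V₂} {G₁ : SimpleGraph W₁} {G₂ : SimpleGraph W₂}
  {s₁ : V₁ → Bool} {s₂ : V₂ → Bool} {π₁ : (V₁ → ZMod 2) → W₁} {π₂ : (V₂ → ZMod 2) → W₂}

theorem IsFlipModel.nonempty_iso_of_bigSides (hM₁ : IsFlipModel T₁ G₁ s₁ π₁)
    (hM₂ : IsFlipModel T₂ G₂ s₂ π₂) (hT₁ : T₁.Connected) (hT₂ : T₂.Connected)
    (hs₁ : T₁.IsSide s₁) (hs₂ : T₂.IsSide s₂) (hb₁ : BigSides s₁) (hb₂ : BigSides s₂)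
    (hcard : Fintype.card V₁ = Fintype.card V₂) (φ : G₁ ≃g G₂) : Nonempty (T₁ ≃g T₂) := by
  have h0 : φ (π₁ 0) = π₂ 0 := by
    refine hM₂.eq_zero_of_card_le hT₂ hs₂ ?_
    rw [φ.ncard_neighborSet, ← hcard]
    exact hM₁.card_le_ncard_neighborSet_zero hb₁
  -- The zero class is fixed by its degree, so its neighbours, the single flips, correspond; this
  -- induces the vertex bijection `e`.
  have hex : ∀ x, ∃ y, φ (π₁ (flipAt 0 x)) = π₂ (flipAt 0 y) := by
    intro x
    have : G₁.Adj (π₁ 0) (π₁ (flipAt 0 x)) :=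
      (hM₁.adj_iff _ _).2 ⟨(hM₁.flip_ne_of_bigSides hb₁ _ _).symm, x, isConstAround_zero x, rfl⟩
    rw [← φ.map_adj_iff, h0] at this
    obtain ⟨Y, hY⟩ := hM₂.surjective (φ (π₁ (flipAt 0 x)))
    rw [← hY] at this ⊢
    obtain ⟨-, y, -, h⟩ := (hM₂.adj_iff _ _).1 this
    exact ⟨y, h.symm⟩
  choose e he using hex
  have hinj : Function.Injective e := by
    intro x y h
    refine hM₁.flip_injective hb₁ 0 (φ.injective ?_)
    simp only [he, h]
  have hbij : Function.Bijective e :=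
    (Fintype.bijective_iff_injective_and_card e).2 ⟨hinj, hcard⟩
  refine ⟨⟨Equiv.ofBijective e hbij, fun {x y} => ?_⟩⟩
  rw [Equiv.ofBijective_apply, Equiv.ofBijective_apply]
  by_cases hxy : x = y
  · simp [hxy]
  rw [hM₁.adj_iff_common_neighbor hT₁ hs₁ hb₁ hxy,
    hM₂.adj_iff_common_neighbor hT₂ hs₂ hb₂ (hinj.ne hxy), ← he, ← he, ← h0]
  refine ⟨fun h Q h1 h2 => φ.injective (h _ (φ.map_adj_iff.2 h1) (φ.map_adj_iff.2 h2)),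
    fun h Q h1 h2 => ?_⟩
  obtain ⟨Q, rfl⟩ := φ.surjective Q
  rw [h Q (φ.map_adj_iff.1 h1) (φ.map_adj_iff.1 h2)]

end Reconstruction

/-! ### Isomorphism from vertex types. -/

section Types

theorem card_filter_eq_one {V : Type*} [Fintype V] {P : V → Prop} [DecidablePred P] {p : V}
    (h : ∀ x, P x ↔ x = p) : (Finset.univ.filter P).card = 1 :=
  Finset.card_eq_one.2 ⟨p, by ext; simp [h]⟩

/-- Graphs whose adjacency depends only on the types of the vertices, with equally many vertices
of each type, are isomorphic. -/
theorem nonempty_iso_of_types {V₁ V₂ ι : Type*} [Fintype V₁] [Fintype V₂] [DecidableEq ι]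
    {T₁ : SimpleGraph V₁} {T₂ : SimpleGraph V₂} (t₁ : V₁ → ι) (t₂ : V₂ → ι) (R : ι → ι → Prop)
    (h₁ : ∀ x y, T₁.Adj x y ↔ R (t₁ x) (t₁ y)) (h₂ : ∀ x y, T₂.Adj x y ↔ R (t₂ x) (t₂ y))
    (hc : ∀ i, (Finset.univ.filter fun x => t₁ x = i).card
      = (Finset.univ.filter fun x => t₂ x = i).card) : Nonempty (T₁ ≃g T₂) := by
  have he : ∀ i, Nonempty ({x // t₁ x = i} ≃ {x // t₂ x = i}) := fun i =>
    ⟨Fintype.equivOfCardEq (by rw [Fintype.card_subtype, Fintype.card_subtype, hc])⟩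
  refine ⟨⟨Equiv.ofFiberEquiv fun i => (he i).some, fun {x y} => ?_⟩⟩
  have ht : ∀ a, t₂ (Equiv.ofFiberEquiv (fun i => (he i).some) a) = t₁ a :=
    Equiv.ofFiberEquiv_map _
  rw [h₁, h₂, ht, ht]

end Types

/-! ### Stars. -/

section Star

variable {V : Type*} {T : SimpleGraph V} {s : V → Bool}

/-- One side of the bipartition consists of the single vertex `p`. -/
def StarSide (s : V → Bool) (p : V) : Prop :=
  ∀ z, s z = s p ↔ z = p

theorem StarSide.adj_iff [Nontrivial V] (hT : T.Connected) (hs : T.IsSide s) {p : V}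
    (hp : StarSide s p) (x y : V) : T.Adj x y ↔ ¬ (x = p ↔ y = p) := by
  have key : ∀ y, y ≠ p → T.Adj p y := by
    intro y hy
    obtain ⟨u, hu⟩ := hT.exists_adj_of_nontrivial y
    have hyp : s y ≠ s p := fun h => hy ((hp y).1 h)
    have : u = p := by
      refine (hp u).1 ?_
      rw [hs y u hu]
      cases h1 : s y <;> cases h2 : s p <;> simp_all
    exact this ▸ hu.symm
  constructor
  · intro h hxy
    refine hs.not_adj ?_ h
    by_cases hx : x = p
    · rw [hx, hxy.1 hx]
    · have hx' : s x ≠ s p := fun h => hx ((hp x).1 h)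
      have hy' : s y ≠ s p := fun h => hx (hxy.2 ((hp y).1 h))
      cases h1 : s x <;> cases h2 : s p <;> cases h3 : s y <;> simp_all
  · intro h
    by_cases hx : x = p
    · subst hx
      exact key y fun hy => h (by simp [hy])
    · by_cases hy : y = p
      · subst hy
        exact (key x hx).symm
      · exact absurd (by simp [hx, hy]) h

theorem StarSide.nonempty_iso {V₂ : Type*} {T₂ : SimpleGraph V₂} {s₂ : V₂ → Bool} [Fintype V]
    [Fintype V₂] [Nontrivial V] [Nontrivial V₂] (hT : T.Connected) (hT₂ : T₂.Connected)
    (hs : T.IsSide s) (hs₂ : T₂.IsSide s₂) {p : V} {p₂ : V₂} (hp : StarSide s p)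
    (hp₂ : StarSide s₂ p₂) (hcard : Fintype.card V = Fintype.card V₂) : Nonempty (T ≃g T₂) := by
  classical
  refine nonempty_iso_of_types (fun x => decide (x = p)) (fun x => decide (x = p₂))
    (fun a b => a ≠ b) (fun x y => ?_) (fun x y => ?_) fun i => ?_
  · rw [hp.adj_iff hT hs, ne_eq, decide_eq_decide]
  · rw [hp₂.adj_iff hT₂ hs₂, ne_eq, decide_eq_decide]
  · cases i
    · simp only [decide_eq_false_iff_not, Finset.filter_not, Finset.card_univ_sdiff,
        card_filter_eq_one fun _ => Iff.rfl, hcard]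
    · simp only [decide_eq_true_eq, card_filter_eq_one fun _ => Iff.rfl]

variable [DecidableEq V] [Fintype V] {W : Type*} {G : SimpleGraph W} {π : (V → ZMod 2) → W}

/-- Flipping the centre complements its whole side, so it never changes the class. -/
theorem IsFlipModel.ncard_neighborSet_lt_of_starSide (hM : IsFlipModel T G s π) {p : V}
    (hp : StarSide s p) (w : W) : (G.neighborSet w).ncard < Fintype.card V := by
  obtain ⟨X, rfl⟩ := hM.surjective w
  refine (hM.ncard_neighborSet_le (Finset.univ.erase p) fun x _ => ?_).trans_lt ?_
  · by_cases hx : x = p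
    · subst hx
      exact Or.inl (hM.flip_eq_self X hp)
    · exact Or.inr ⟨x, by simp [hx], rfl⟩
  · exact Finset.card_lt_card (Finset.erase_ssubset (Finset.mem_univ p))

/-- A leaf sees only the centre and is always free. With at least three leaves their flips are
distinct and nontrivial, hence the bound on the order. -/
theorem IsFlipModel.le_ncard_neighborSet_of_starSide [Nontrivial V] (hM : IsFlipModel T G s π)
    (hT : T.Connected) (hs : T.IsSide s) {p : V}
    (hp : StarSide s p) (hV : 4 ≤ Fintype.card V) (w : W) :
    Fintype.card V ≤ (G.neighborSet w).ncard + 1 := by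
  obtain ⟨X, rfl⟩ := hM.surjective w
  have hne : ∀ {x}, x ≠ p → s x = !(s p) := by
    intro x hx
    have hx' : s x ≠ s p := fun h => hx ((hp x).1 h)
    cases h1 : s x <;> cases h2 : s p <;> simp_all
  have hthird : ∀ x y, ∃ z, z ≠ p ∧ z ≠ x ∧ z ≠ y := by
    intro x y
    have : ({p, x, y} : Finset V).card < Fintype.card V := Finset.card_le_three.trans_lt hV
    obtain ⟨z, hz⟩ := Finset.exists_mem_notMem_of_card_lt_card (t := Finset.univ) this
    exact ⟨z, by simpa using hz⟩
  have := hM.card_le_ncard_neighborSet (X := X) (Finset.univ.erase p) (fun x hx a b ha hb => ?_)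
    (fun x hx => ?_) (fun x hx y hy hxy => ?_)
  · rw [Finset.card_erase_of_mem (Finset.mem_univ _), Finset.card_univ] at this
    omega
  · have hx : x ≠ p := by simpa using hx
    rw [hp.adj_iff hT hs] at ha hb
    simp only [hx, false_iff, not_not] at ha hb
    rw [ha, hb]
  · have hx : x ≠ p := by simpa using hx
    obtain ⟨z, hzp, hzx, -⟩ := hthird x x
    exact hM.flip_ne (by rw [hne hx, hne hzp]) hzx
  · have hx : x ≠ p := by simpa using hx
    by_contra h
    obtain ⟨z, hzp, hzx, hzy⟩ := hthird x y
    have := hM.pair_of_flip_eq h hxy (z := z) (Or.inl (by rw [hne hx, hne hzp]))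
    tauto

end Star

/-! ### Double brooms: trees with a side of size two. -/

section Double

/-- One side of the bipartition is `{v, w}`, the other side has at least two elements, and `u`
is the common neighbour of `v` and `w`. -/
structure IsDoubleBroom {V : Type*} (T : SimpleGraph V) (s : V → Bool) (v w u : V) : Prop where
  ne : v ≠ w
  side : ∀ z, s z = s v ↔ z = v ∨ z = w
  other : ∀ p, ∃ z, s z ≠ s v ∧ z ≠ p
  adj_iff : ∀ z, T.Adj v z ∧ T.Adj w z ↔ z = u
  adj_of_ne : ∀ z, s z ≠ s v → T.Adj v z ∨ T.Adj w z

variable {V : Type*} {T : SimpleGraph V} {s : V → Bool} {v w u : V}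

theorem IsTree.exists_isDoubleBroom [Nontrivial V] (hT : T.IsTree) (hs : T.IsSide s)
    (ne : v ≠ w) (side : ∀ z, s z = s v ↔ z = v ∨ z = w)
    (other : ∀ p, ∃ z, s z ≠ s v ∧ z ≠ p) : ∃ u, IsDoubleBroom T s v w u := by
  have hadj : ∀ z, s z ≠ s v → T.Adj v z ∨ T.Adj w z := by
    intro z hz
    obtain ⟨u, hu⟩ := hT.connected.exists_adj_of_nontrivial z
    have : s u = s v := by
      rw [hs z u hu]
      cases h1 : s z <;> cases h2 : s v <;> simp_all
    rcases (side u).1 this with rfl | rfl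
    · exact Or.inl hu.symm
    · exact Or.inr hu.symm
  have hwv : s w = s v := (side w).2 (Or.inr rfl)
  have hsv : ∀ {a b}, T.Adj a b → s a = s v → ¬ s b = s v := fun h ha hb =>
    hs.not_adj (ha.trans hb.symm) h
  have hsv' : ∀ {a b}, T.Adj a b → s a ≠ s v → s b = s v := by
    intro a b h ha
    rw [hs a b h]
    cases h1 : s a <;> cases h2 : s v <;> simp_all
  -- Without a common neighbour, `v` and its neighbours would be closed under adjacency and miss
  -- `w`. Uniqueness of `u` follows since two common neighbours give two paths from `v` to `w`.
  obtain ⟨u, hu⟩ : ∃ u, T.Adj v u ∧ T.Adj w u := by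
    by_contra! h
    have := hT.connected.eq_of_forall_adj (f := fun z => z = v ∨ T.Adj v z) (fun a b hab => by
      have key : ∀ a b, T.Adj a b → (a = v ∨ T.Adj v a) → (b = v ∨ T.Adj v b) := by
        rintro a b hab (rfl | ha)
        · exact Or.inr hab
        · have hb := hsv' hab (hsv ha rfl)
          rcases (side b).1 hb with rfl | rfl
          · exact Or.inl rfl
          · exact absurd hab.symm (h a ha)
      exact propext ⟨key a b hab, key b a hab.symm⟩) v w
    simp only [true_or, eq_iff_iff, true_iff] at this
    rcases this with h | h
    · exact ne h.symm
    · exact hs.not_adj hwv.symm h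
  refine ⟨u, ne, side, other, fun z => ⟨fun hz => ?_, fun hz => hz ▸ hu⟩, hadj⟩
  by_contra hzu
  have hp : ∀ {z} (h1 : T.Adj v z) (h2 : T.Adj w z),
      (Walk.cons h1 (Walk.cons h2.symm Walk.nil) : T.Walk v w).IsPath := by
    intro z h1 h2
    simp [Walk.cons_isPath_iff, h1.ne, h2.ne', ne]
  have := (hT.existsUnique_path v w).unique (hp hu.1 hu.2) (hp hz.1 hz.2)
  simp only [Walk.cons.injEq] at this
  exact hzu this.1.symm

namespace IsDoubleBroom

theorem swap (hD : IsDoubleBroom T s v w u) : IsDoubleBroom T s w v u where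
  ne := hD.ne.symm
  side z := by
    rw [(hD.side w).2 (Or.inr rfl), hD.side z, or_comm]
  other p := by
    rw [(hD.side w).2 (Or.inr rfl)]
    exact hD.other p
  adj_iff z := by
    rw [and_comm, hD.adj_iff]
  adj_of_ne z hz := by
    rw [(hD.side w).2 (Or.inr rfl)] at hz
    exact (hD.adj_of_ne z hz).symm

theorem side_w (hD : IsDoubleBroom T s v w u) : s w = s v := (hD.side w).2 (Or.inr rfl)

theorem adj_vu (hD : IsDoubleBroom T s v w u) : T.Adj v u := ((hD.adj_iff u).2 rfl).1

theorem adj_wu (hD : IsDoubleBroom T s v w u) : T.Adj w u := ((hD.adj_iff u).2 rfl).2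

theorem not_adj_w (hD : IsDoubleBroom T s v w u) (hs : T.IsSide s) {z : V} (hz : s z = s v) : ¬ T.Adj w z :=
  hs.not_adj (hD.side_w.trans hz.symm)

theorem u_side (hD : IsDoubleBroom T s v w u) (hs : T.IsSide s) : s u ≠ s v := fun h => hs.not_adj h.symm hD.adj_vu

end IsDoubleBroom

end Double

/-! ### Isomorphism type and degree count of double brooms. -/

section DoubleModel

variable {V : Type*} {T : SimpleGraph V} {s : V → Bool} {v w u : V}

namespace IsDoubleBroom

theorem eq_or_eq_of_adj (hD : IsDoubleBroom T s v w u) (hs : T.IsSide s) {x z : V}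
    (hx : s x ≠ s v) (h : T.Adj x z) : z = v ∨ z = w := by
  refine (hD.side z).1 ?_
  rw [hs x z h]
  cases h1 : s x <;> cases h2 : s v <;> simp_all

theorem adj_iff_or (hD : IsDoubleBroom T s v w u) (hs : T.IsSide s) (x y : V) :
    T.Adj x y ↔ (x = v ∧ T.Adj v y) ∨ (x = w ∧ T.Adj w y) ∨ (y = v ∧ T.Adj v x) ∨
      (y = w ∧ T.Adj w x) := by
  constructor
  · intro h
    by_cases hx : s x = s v
    · rcases (hD.side x).1 hx with rfl | rfl
      · exact Or.inl ⟨rfl, h⟩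
      · exact Or.inr (Or.inl ⟨rfl, h⟩)
    · rcases hD.eq_or_eq_of_adj hs hx h with rfl | rfl
      · exact Or.inr (Or.inr (Or.inl ⟨rfl, h.symm⟩))
      · exact Or.inr (Or.inr (Or.inr ⟨rfl, h.symm⟩))
  · rintro (⟨rfl, h⟩ | ⟨rfl, h⟩ | ⟨rfl, h⟩ | ⟨rfl, h⟩)
    exacts [h, h, h.symm, h.symm]

open Classical in
/-- The role of a vertex in a double broom. -/
noncomputable def role (T : SimpleGraph V) (v w u : V) (x : V) : Fin 5 :=
  if x = v then 0 else if x = w then 1 else if x = u then 2 else if T.Adj v x then 3 else 4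

theorem role_spec (hD : IsDoubleBroom T s v w u) (hs : T.IsSide s) (x : V) :
    (role T v w u x = 0 ↔ x = v) ∧ (role T v w u x = 1 ↔ x = w) ∧ (role T v w u x = 2 ↔ x = u) ∧
    (role T v w u x = 3 ↔ T.Adj v x ∧ ¬ T.Adj w x) ∧
    (role T v w u x = 4 ↔ T.Adj w x ∧ ¬ T.Adj v x) := by
  have h1 := hD.ne
  have h2 := hD.adj_iff x
  have h3 := hD.adj_of_ne x
  have h4 := hD.side x
  have h5 : s x = s v → ¬ T.Adj v x := fun h => hs.not_adj h.symm
  have h6 : s x = s v → ¬ T.Adj w x := hD.not_adj_w hs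
  have h7 : u ≠ v := hD.adj_vu.ne'
  have h8 : u ≠ w := hD.adj_wu.ne'
  simp only [role]
  split_ifs <;> simp_all

/-- The adjacency between the roles of the vertices of a double broom. -/
def RoleAdj (i j : Fin 5) : Prop :=
  (i = 0 ∧ (j = 2 ∨ j = 3)) ∨ (i = 1 ∧ (j = 2 ∨ j = 4)) ∨
    (j = 0 ∧ (i = 2 ∨ i = 3)) ∨ (j = 1 ∧ (i = 2 ∨ i = 4))

theorem adj_iff_roleAdj (hD : IsDoubleBroom T s v w u) (hs : T.IsSide s) (x y : V) :
    T.Adj x y ↔ RoleAdj (role T v w u x) (role T v w u y) := by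
  have key : ∀ x, (T.Adj v x ↔ role T v w u x = 2 ∨ role T v w u x = 3) ∧
      (T.Adj w x ↔ role T v w u x = 2 ∨ role T v w u x = 4) := by
    intro x
    obtain ⟨-, -, h2, h3, h4⟩ := hD.role_spec hs x
    have := hD.adj_iff x
    tauto
  rw [hD.adj_iff_or hs, RoleAdj, (key x).1, (key x).2, (key y).1, (key y).2,
    (hD.role_spec hs x).1, (hD.role_spec hs x).2.1, (hD.role_spec hs y).1,
    (hD.role_spec hs y).2.1]

variable [Fintype V]

open Classical in
/-- The neighbours of `v` that are not neighbours of `w`. -/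
noncomputable def privateNeighbors (T : SimpleGraph V) (v w : V) : Finset V :=
  Finset.univ.filter fun x => T.Adj v x ∧ ¬ T.Adj w x

theorem mem_privateNeighbors {x : V} :
    x ∈ privateNeighbors T v w ↔ T.Adj v x ∧ ¬ T.Adj w x := by
  simp [privateNeighbors]

theorem disjoint_privateNeighbors :
    Disjoint (privateNeighbors T v w) (privateNeighbors T w v) := by
  rw [Finset.disjoint_left]
  intro x h1 h2
  rw [mem_privateNeighbors] at h1 h2
  exact h1.2 h2.1

theorem nonempty_iso {V₂ : Type*} [Fintype V₂] {T₂ : SimpleGraph V₂} {s₂ : V₂ → Bool}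
    {v₂ w₂ u₂ : V₂} (hD : IsDoubleBroom T s v w u) (hs : T.IsSide s)
    (hD₂ : IsDoubleBroom T₂ s₂ v₂ w₂ u₂) (hs₂ : T₂.IsSide s₂)
    (ha : (privateNeighbors T v w).card = (privateNeighbors T₂ v₂ w₂).card)
    (hb : (privateNeighbors T w v).card = (privateNeighbors T₂ w₂ v₂).card) :
    Nonempty (T ≃g T₂) := by
  have h := hD.role_spec hs
  have h₂ := hD₂.role_spec hs₂
  refine nonempty_iso_of_types _ _ RoleAdj (hD.adj_iff_roleAdj hs) (hD₂.adj_iff_roleAdj hs₂)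
    fun i => ?_
  fin_cases i
  · exact (card_filter_eq_one fun x => (h x).1).trans
      (card_filter_eq_one fun x => (h₂ x).1).symm
  · exact (card_filter_eq_one fun x => (h x).2.1).trans
      (card_filter_eq_one fun x => (h₂ x).2.1).symm
  · exact (card_filter_eq_one fun x => (h x).2.2.1).trans
      (card_filter_eq_one fun x => (h₂ x).2.2.1).symm
  · refine (congrArg Finset.card (Finset.ext fun x => ?_)).trans
      (ha.trans (congrArg Finset.card (Finset.ext fun x => ?_)))
    · rw [mem_privateNeighbors, ← (h x).2.2.2.1, Finset.mem_filter_univ]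
      rfl
    · rw [mem_privateNeighbors, ← (h₂ x).2.2.2.1, Finset.mem_filter_univ]
      rfl
  · refine (congrArg Finset.card (Finset.ext fun x => ?_)).trans
      (hb.trans (congrArg Finset.card (Finset.ext fun x => ?_)))
    · rw [mem_privateNeighbors, ← (h x).2.2.2.2, Finset.mem_filter_univ]
      rfl
    · rw [mem_privateNeighbors, ← (h₂ x).2.2.2.2, Finset.mem_filter_univ]
      rfl

theorem card_eq (hD : IsDoubleBroom T s v w u) (hs : T.IsSide s) :
    (privateNeighbors T v w).card + (privateNeighbors T w v).card + 3 = Fintype.card V := by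
  classical
  have h := Finset.card_eq_sum_card_fiberwise (s := Finset.univ) (t := Finset.univ)
    (f := role T v w u) (fun _ _ => Finset.mem_univ _)
  simp only [Fin.sum_univ_five, hD.role_spec hs] at h
  rw [Finset.card_univ, card_filter_eq_one fun _ => Iff.rfl, card_filter_eq_one fun _ => Iff.rfl,
    card_filter_eq_one fun _ => Iff.rfl] at h
  rw [h]
  simp only [privateNeighbors]
  ring

end IsDoubleBroom

variable [DecidableEq V] {W : Type*} {G : SimpleGraph W} {π : (V → ZMod 2) → W}

namespace IsFlipModel

theorem flip_v_eq_flip_w (hM : IsFlipModel T G s π) (hD : IsDoubleBroom T s v w u)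
    (X : V → ZMod 2) : π (flipAt X v) = π (flipAt X w) :=
  hM.flip_eq_of_pair X hD.ne hD.side

variable [Fintype V]

theorem ncard_neighborSet_lt_of_isDoubleBroom (hM : IsFlipModel T G s π)
    (hD : IsDoubleBroom T s v w u) (x : W) : (G.neighborSet x).ncard < Fintype.card V := by
  obtain ⟨X, rfl⟩ := hM.surjective x
  refine (hM.ncard_neighborSet_le (Finset.univ.erase w) fun x _ => ?_).trans_lt ?_
  · by_cases hx : x = w
    · subst hx
      exact Or.inr ⟨v, by simp [hD.ne], hM.flip_v_eq_flip_w hD X⟩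
    · exact Or.inr ⟨x, by simp [hx], rfl⟩
  · exact Finset.card_lt_card (Finset.erase_ssubset (Finset.mem_univ w))

/-- Two flips are lost: `u` is frozen between `v` and `w`, and the flip at `w` duplicates the one at
`v`. -/
theorem ncard_neighborSet_add_two_le_of_ne (hM : IsFlipModel T G s π)
    (hD : IsDoubleBroom T s v w u) {X : V → ZMod 2} (hX : X v ≠ X w) :
    (G.neighborSet (π X)).ncard + 2 ≤ Fintype.card V := by
  have := hM.ncard_neighborSet_le (X := X) (Finset.univ \ {w, u}) fun x hxc => ?_
  · rw [Finset.card_univ_sdiff, Finset.card_pair hD.adj_wu.ne] at this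
    have h2 := Finset.card_le_univ ({w, u} : Finset V)
    rw [Finset.card_pair hD.adj_wu.ne] at h2
    omega
  · have hxu : x ≠ u := by
      rintro rfl
      exact hX (hxc v w hD.adj_vu.symm hD.adj_wu.symm)
    by_cases hx : x = w
    · subst hx
      exact Or.inr ⟨v, by simp [hD.ne, hD.adj_vu.ne], hM.flip_v_eq_flip_w hD X⟩
    · exact Or.inr ⟨x, by simp [hx, hxu], rfl⟩

theorem ncard_neighborSet_add_two_le_of_not_const (hM : IsFlipModel T G s π)
    (hD : IsDoubleBroom T s v w u) {X : V → ZMod 2} (hv : ¬ T.IsConstAround X v)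
    (hw : ¬ T.IsConstAround X w) : (G.neighborSet (π X)).ncard + 2 ≤ Fintype.card V := by
  have := hM.ncard_neighborSet_le (X := X) (Finset.univ \ {v, w}) fun x hxc => ?_
  · rw [Finset.card_univ_sdiff, Finset.card_pair hD.ne] at this
    have h2 := Finset.card_le_univ ({v, w} : Finset V)
    rw [Finset.card_pair hD.ne] at h2
    omega
  · have hxv : x ≠ v := by
      rintro rfl
      exact hv hxc
    have hxw : x ≠ w := by
      rintro rfl
      exact hw hxc
    exact Or.inr ⟨x, by simp [hxv, hxw], rfl⟩

theorem exists_ncard_neighborSet_of_isDoubleBroom (hM : IsFlipModel T G s π)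
    (hD : IsDoubleBroom T s v w u) : ∃ x, (G.neighborSet x).ncard + 2 ≤ Fintype.card V :=
  ⟨_, hM.ncard_neighborSet_add_two_le_of_ne hD (X := flipAt 0 v) (by simp [flipAt, hD.ne.symm])⟩

/-- Equality at `v` and `w` frees the whole other side, and `v` is free by assumption; only `w` is
dropped. Five vertices put three on the other side, which keeps the flips there distinct. -/
theorem le_ncard_neighborSet_of_isConstAround (hM : IsFlipModel T G s π)
    (hD : IsDoubleBroom T s v w u) (hs : T.IsSide s) (hV : 5 ≤ Fintype.card V) {X : V → ZMod 2}
    (hX : X v = X w) (hv : T.IsConstAround X v) :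
    Fintype.card V ≤ (G.neighborSet (π X)).ncard + 1 := by
  have hne : ∀ {x y}, s x ≠ s v → s y ≠ s v → s x = s y := by
    intro x y hx hy
    cases h1 : s x <;> cases h2 : s v <;> cases h3 : s y <;> simp_all
  have := hM.card_le_ncard_neighborSet (X := X) (Finset.univ.erase w) (fun x hx => ?_)
    (fun x hx => ?_) (fun x hx y hy hxy => ?_)
  · rw [Finset.card_erase_of_mem (Finset.mem_univ _), Finset.card_univ] at this
    omega
  · by_cases hsx : s x = s v
    · rcases (hD.side x).1 hsx with rfl | rfl
      · exact hv
      · simp at hx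
    · intro a b ha hb
      rcases hD.eq_or_eq_of_adj hs hsx ha with rfl | rfl <;>
        rcases hD.eq_or_eq_of_adj hs hsx hb with rfl | rfl <;> simp [hX]
  · by_cases hsx : s x = s v
    · exact hM.flip_ne (z := w) (hD.side_w.trans hsx.symm) (Finset.ne_of_mem_erase hx).symm
    · obtain ⟨z, hz, hzx⟩ := hD.other x
      exact hM.flip_ne (hne hz hsx) hzx
  · by_contra h
    have hx := Finset.ne_of_mem_erase hx
    have hy := Finset.ne_of_mem_erase hy
    have key := fun z => hM.pair_of_flip_eq h hxy (z := z)
    by_cases hsx : s x = s v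
    · rcases key w (Or.inl (hD.side_w.trans hsx.symm)) with h | h
      exacts [hx h.symm, hy h.symm]
    · by_cases hsy : s y = s v
      · rcases key w (Or.inr (hD.side_w.trans hsy.symm)) with h | h
        exacts [hx h.symm, hy h.symm]
      · have : ({v, w, x, y} : Finset V).card < Fintype.card V :=
          Finset.card_le_four.trans_lt hV
        obtain ⟨z, -, hz⟩ := Finset.exists_mem_notMem_of_card_lt_card (t := Finset.univ) this
        simp only [Finset.mem_insert, Finset.mem_singleton, not_or] at hz
        have hsz : s z ≠ s v := fun h => by
          rcases (hD.side z).1 h with h | h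
          exacts [hz.1 h, hz.2.1 h]
        rcases key z (Or.inl (hne hsz hsx)) with h | h
        exacts [hz.2.2.1 h, hz.2.2.2 h]

/-- The state given by the indicator function of a set of vertices. -/
def indicatorState (S : Finset V) : V → ZMod 2 := fun x => if x ∈ S then 1 else 0

open IsDoubleBroom in
theorem le_ncard_neighborSet_indicatorState (hM : IsFlipModel T G s π)
    (hD : IsDoubleBroom T s v w u) (hs : T.IsSide s) (hV : 5 ≤ Fintype.card V) {S : Finset V}
    (hS : S ⊆ privateNeighbors T v w) :
    Fintype.card V ≤ (G.neighborSet (π (indicatorState S))).ncard + 1 := by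
  have hv : v ∉ S := fun h => (mem_privateNeighbors.1 (hS h)).1.ne rfl
  have hw : w ∉ S := fun h => hs.not_adj hD.side_w.symm (mem_privateNeighbors.1 (hS h)).1
  refine hM.le_ncard_neighborSet_of_isConstAround hD.swap hs hV ?_ ?_
  · simp [indicatorState, hv, hw]
  · have : ∀ a, T.Adj w a → a ∉ S := fun a ha h => (mem_privateNeighbors.1 (hS h)).2 ha
    intro a b ha hb
    simp [indicatorState, this a ha, this b hb]

open IsDoubleBroom in
-- Complementing sides normalises X to vanish on {v, w} and at `u`. As X is constant around `w`,
-- what remains lies among the private neighbours of `v`.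
theorem exists_indicatorState (hM : IsFlipModel T G s π)
    (hD : IsDoubleBroom T s v w u) {X : V → ZMod 2} (hX : X v = X w)
    (hw : T.IsConstAround X w) :
    ∃ S ⊆ privateNeighbors T v w, π (indicatorState S) = π X := by
  have zmod2 : ∀ a b : ZMod 2, a ≠ b → a + b = 1 := by decide
  let d : Bool → ZMod 2 := fun c => if c = s v then X v else X u
  have hdv : d (s v) = X v := by simp [d]
  have hdne : ∀ x, s x ≠ s v → d (s x) = X u := fun x hx => by simp [d, hx]
  have hside : ∀ x, s x = s v → X x = d (s x) := by
    intro x hx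
    rw [hx, hdv]
    rcases (hD.side x).1 hx with rfl | rfl
    · rfl
    · exact hX.symm
  refine ⟨Finset.univ.filter fun x => X x ≠ d (s x), fun x hx => ?_, ?_⟩
  · have hx : X x ≠ d (s x) := by simpa using hx
    have hsx : s x ≠ s v := fun h => hx (hside x h)
    have hnw : ¬ T.Adj w x := fun h => hx (by rw [hdne x hsx]; exact hw x u h hD.adj_wu)
    exact mem_privateNeighbors.2 ⟨(hD.adj_of_ne x hsx).resolve_right hnw, hnw⟩
  · refine ((hM.eq_iff _ _).2 ⟨d, fun x => ?_⟩).symm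
    by_cases hx : X x = d (s x)
    · simp [indicatorState, hx, CharTwo.add_self_eq_zero]
    · simp [indicatorState, hx, zmod2 _ _ hx]

-- The classes of maximal degree are those where X agrees on `v` and `w` and at least one of these
-- is free. They are the subsets of either private neighbourhood, and the two families share only
-- the empty set, which accounts for the added 1.
open IsDoubleBroom in
theorem two_pow_add_two_pow (hM : IsFlipModel T G s π)
    (hD : IsDoubleBroom T s v w u) (hs : T.IsSide s) (hV : 5 ≤ Fintype.card V) :
    2 ^ (privateNeighbors T v w).card + 2 ^ (privateNeighbors T w v).card
      = {x | Fintype.card V ≤ (G.neighborSet x).ncard + 1}.ncard + 1 := by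
  classical
  set A := privateNeighbors T v w with hA
  set B := privateNeighbors T w v with hB
  have hset : {x | Fintype.card V ≤ (G.neighborSet x).ncard + 1}
      = ((A.powerset ∪ B.powerset).image fun S => π (indicatorState S) : Finset W) := by
    ext x
    simp only [Set.mem_ofPred_eq, Finset.coe_image, Set.mem_image, Finset.mem_coe,
      Finset.mem_union, Finset.mem_powerset]
    constructor
    · intro hx
      obtain ⟨X, rfl⟩ := hM.surjective x
      have hX : X v = X w := by
        by_contra h
        have := hM.ncard_neighborSet_add_two_le_of_ne hD h
        omega
      by_cases hw : T.IsConstAround X w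
      · obtain ⟨S, hS, h⟩ := hM.exists_indicatorState hD hX hw
        exact ⟨S, Or.inl hS, h⟩
      · have hv : T.IsConstAround X v := by
          by_contra hv
          have := hM.ncard_neighborSet_add_two_le_of_not_const hD hv hw
          omega
        obtain ⟨S, hS, h⟩ := hM.exists_indicatorState hD.swap hX.symm hv
        exact ⟨S, Or.inr hS, h⟩
    · rintro ⟨S, hS | hS, rfl⟩
      · exact hM.le_ncard_neighborSet_indicatorState hD hs hV hS
      · exact hM.le_ncard_neighborSet_indicatorState hD.swap hs hV hS
  have hinj : Set.InjOn (fun S => π (indicatorState S)) (A.powerset ∪ B.powerset : Finset _) := by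
    have hmem : ∀ S ∈ A.powerset ∪ B.powerset, ∀ x ∈ S, x ≠ u ∧ s x ≠ s v := by
      intro S hS x hx
      rw [Finset.mem_union, Finset.mem_powerset, Finset.mem_powerset] at hS
      rcases hS with hS | hS
      · have := mem_privateNeighbors.1 (hS hx)
        refine ⟨?_, fun h => hs.not_adj h.symm this.1⟩
        rintro rfl
        exact this.2 hD.adj_wu
      · have := mem_privateNeighbors.1 (hS hx)
        refine ⟨?_, fun h => hD.not_adj_w hs h this.1⟩
        rintro rfl
        exact this.2 hD.adj_vu
    intro S hS S' hS' h
    obtain ⟨d, hd⟩ := (hM.eq_iff _ _).1 h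
    have hmS := hmem S hS
    have hmS' := hmem S' hS'
    -- No such set contains `u`, which rules out complementation on its side and makes the normal
    -- form unique.
    have hdu : d (s u) = 0 := by
      have h1 : u ∉ S := fun h => (hmS u h).1 rfl
      have h2 : u ∉ S' := fun h => (hmS' u h).1 rfl
      simpa [indicatorState, h1, h2] using (hd u).symm
    ext x
    by_cases hsx : s x = s v
    · exact iff_of_false (fun h => (hmS x h).2 hsx) (fun h => (hmS' x h).2 hsx)
    · have hxu : s x = s u := by
        have := hD.u_side hs
        cases h1 : s x <;> cases h2 : s v <;> cases h3 : s u <;> simp_all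
      have := hd x
      rw [hxu, hdu, add_zero] at this
      by_cases h1 : x ∈ S <;> by_cases h2 : x ∈ S' <;> simp_all [indicatorState]
  have hinter : A.powerset ∩ B.powerset = {∅} := by
    ext S
    rw [Finset.mem_inter, Finset.mem_powerset, Finset.mem_powerset, ← Finset.subset_inter_iff,
      Finset.disjoint_iff_inter_eq_empty.1 disjoint_privateNeighbors, Finset.subset_empty,
      Finset.mem_singleton]
  have := Finset.card_union_add_card_inter A.powerset B.powerset
  rw [hset, Set.ncard_coe_finset, Finset.card_image_of_injOn hinj]
  rw [hinter, Finset.card_powerset, Finset.card_powerset, Finset.card_singleton] at this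
  omega

end IsFlipModel

end DoubleModel

/-! ### Functoriality under graph isomorphism. -/

section Transport

variable {V₁ V₂ : Type*} [DecidableEq V₁] [DecidableEq V₂]
  {T₁ : SimpleGraph V₁} {T₂ : SimpleGraph V₂}

theorem IsStablePartition.map {k : ℕ} {P : Multiset (Finset V₁)}
    (hP : T₁.IsStablePartition k P) (e : T₁ ≃g T₂) :
    T₂.IsStablePartition k (P.map fun S => S.map e.toEquiv.toEmbedding) where
  card_eq := by rw [Multiset.card_map, hP.card_eq]
  indep := by
    intro S hS
    obtain ⟨S', hS', rfl⟩ := Multiset.mem_map.1 hS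
    intro x hx y hy hxy hadj
    simp only [Finset.coe_map, Set.mem_image, Finset.mem_coe] at hx hy
    obtain ⟨x, hx, rfl⟩ := hx
    obtain ⟨y, hy, rfl⟩ := hy
    exact hP.indep S' hS' hx hy (fun h => hxy (by rw [h])) (e.map_adj_iff.1 hadj)
  cover v := by
    obtain ⟨v, rfl⟩ := e.surjective v
    rw [Multiset.countP_map, ← hP.cover v, Multiset.countP_eq_card_filter]
    congr 1
    refine Multiset.filter_congr fun S _ => ?_
    exact Finset.mem_map' e.toEquiv.toEmbedding

theorem partitionDelete_map (e : V₁ ≃ V₂) (P : Multiset (Finset V₁)) (v : V₁) :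
    partitionDelete (P.map fun S => S.map e.toEmbedding) (e v)
      = (partitionDelete P v).map fun S => S.map e.toEmbedding := by
  simp only [partitionDelete, Multiset.map_map]
  refine Multiset.map_congr rfl fun S _ => ?_
  exact (Finset.map_erase e.toEmbedding S v).symm

/-- Isomorphic graphs have isomorphic Bell colouring graphs. -/
def Iso.bellColoringGraph (e : T₁ ≃g T₂) (k : ℕ) :
    T₁.bellColoringGraph k ≃g T₂.bellColoringGraph k where
  toFun P := ⟨_, P.2.map e⟩
  invFun P := ⟨_, P.2.map e.symm⟩
  left_inv P := Subtype.ext (by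
    simp only [Multiset.map_map]
    conv_rhs => rw [← Multiset.map_id P.1]
    refine Multiset.map_congr rfl fun S _ => ?_
    ext x
    simp only [Function.comp_apply, Finset.mem_map_equiv, id_eq]
    exact iff_of_eq (congrArg (· ∈ S) (e.symm_apply_apply x)))
  right_inv P := Subtype.ext (by
    simp only [Multiset.map_map]
    conv_rhs => rw [← Multiset.map_id P.1]
    refine Multiset.map_congr rfl fun S _ => ?_
    ext x
    simp only [Function.comp_apply, Finset.mem_map_equiv, id_eq]
    exact iff_of_eq (congrArg (· ∈ S) (e.apply_symm_apply x)))
  map_rel_iff' {P Q} := by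
    have hinj : Function.Injective
        (Multiset.map fun S : Finset V₁ => S.map e.toEquiv.toEmbedding) :=
      Multiset.map_injective (Finset.map_injective _)
    refine and_congr (not_congr ?_) ?_
    · rw [Subtype.ext_iff, Subtype.ext_iff]
      exact hinj.eq_iff
    · constructor
      · rintro ⟨v, hv⟩
        obtain ⟨v, rfl⟩ := e.surjective v
        refine ⟨v, hinj ?_⟩
        rw [← partitionDelete_map, ← partitionDelete_map]
        exact hv
      · rintro ⟨v, hv⟩
        refine ⟨e v, ?_⟩
        have := congrArg (Multiset.map fun S : Finset V₁ => S.map e.toEquiv.toEmbedding) hv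
        rw [← partitionDelete_map, ← partitionDelete_map] at this
        exact this

end Transport

/-! ### Trichotomy of trees and comparison of the cases. -/

theorem IsTree.bigSides_or_starSide_or_isDoubleBroom {V : Type*} [Nontrivial V]
    {T : SimpleGraph V} (hT : T.IsTree) {s : V → Bool} (hs : T.IsSide s) :
    BigSides s ∨ (∃ p, StarSide s p) ∨ ∃ v w u, IsDoubleBroom T s v w u := by
  by_cases hb : BigSides s
  · exact Or.inl hb
  refine Or.inr ?_
  by_cases hst : ∃ p, StarSide s p
  · exact Or.inl hst
  refine Or.inr ?_
  simp only [BigSides, not_forall] at hb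
  obtain ⟨c, x, y, hb⟩ := hb
  have hc : ∀ z, s z = c → z = x ∨ z = y := by
    intro z hz
    by_contra! h
    exact hb ⟨z, hz, h.1, h.2⟩
  have hnt : ∀ c p, ∃ z, s z = c ∧ z ≠ p := by
    intro c p
    by_contra! h
    obtain ⟨q, rfl⟩ := hT.connected.isSide_surjective hs c
    have hq := h q rfl
    refine hst ⟨q, fun z => ⟨fun hz => (h z hz).trans hq.symm, fun hz => by rw [hz]⟩⟩
  obtain ⟨v, hv, hvy⟩ := hnt c y
  obtain ⟨w, hw, hwx⟩ := hnt c x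
  have hvx : v = x := (hc v hv).resolve_right hvy
  have hwy : w = y := (hc w hw).resolve_left hwx
  subst hvx hwy hv
  have hside : ∀ z, s z = s v ↔ z = v ∨ z = w := fun z =>
    ⟨hc z, by rintro (rfl | rfl) <;> simp [hw]⟩
  refine ⟨v, w, hT.exists_isDoubleBroom hs hvy hside fun p => ?_⟩
  obtain ⟨z, hz, hzp⟩ := hnt (!(s v)) p
  exact ⟨z, by simp [hz], hzp⟩

theorem eq_or_eq_of_two_pow_add_two_pow {a b c d : ℕ} (h : a + b = c + d)
    (h2 : 2 ^ a + 2 ^ b = 2 ^ c + 2 ^ d) : (a = c ∧ b = d) ∨ (a = d ∧ b = c) := by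
  have hm : (2 : ℤ) ^ a * 2 ^ b = 2 ^ c * 2 ^ d := by rw [← pow_add, ← pow_add, h]
  have h2' : (2 : ℤ) ^ a + 2 ^ b = 2 ^ c + 2 ^ d := by exact_mod_cast h2
  -- Both pairs of powers have the same sum and product, so they are the roots of one quadratic.
  have h0 : ((2 : ℤ) ^ a - 2 ^ c) * (2 ^ a - 2 ^ d) = 0 := by linear_combination 2 ^ a * h2' - hm
  have inj : ∀ {m n : ℕ}, (2 : ℤ) ^ m - 2 ^ n = 0 → m = n := fun h =>
    Int.pow_right_injective (by norm_num) (sub_eq_zero.1 h)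
  rcases mul_eq_zero.1 h0 with h | h
  · have := inj h
    omega
  · have := inj h
    omega

theorem card_eq_one_of_subsingleton (V : Type*) [Fintype V] [Nonempty V] [Subsingleton V] :
    Fintype.card V = 1 :=
  le_antisymm (Fintype.card_le_one_iff_subsingleton.2 ‹_›) Fintype.card_pos

section Classification

variable {V₁ V₂ W₁ W₂ : Type*} [Fintype V₁] [Fintype V₂] [DecidableEq V₁]
  {T₁ : SimpleGraph V₁} {T₂ : SimpleGraph V₂} {G₁ : SimpleGraph W₁} {G₂ : SimpleGraph W₂}
  {s₁ : V₁ → Bool} {s₂ : V₂ → Bool} {π₁ : (V₁ → ZMod 2) → W₁} {π₂ : (V₂ → ZMod 2) → W₂}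

namespace IsFlipModel

theorem not_bigSides_of_iso (hM₁ : IsFlipModel T₁ G₁ s₁ π₁)
    (hcard : Fintype.card V₁ = Fintype.card V₂) (φ : G₁ ≃g G₂)
    (h : ∀ w, (G₂.neighborSet w).ncard < Fintype.card V₂) : ¬ BigSides s₁ := by
  intro hb
  have h1 := hM₁.card_le_ncard_neighborSet_zero hb
  have h2 := h (φ (π₁ 0))
  rw [φ.ncard_neighborSet] at h2
  omega

variable [DecidableEq V₂]

theorem not_starSide_of_iso [Nontrivial V₁] (hM₁ : IsFlipModel T₁ G₁ s₁ π₁)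
    (hM₂ : IsFlipModel T₂ G₂ s₂ π₂) (hT₁ : T₁.Connected) (hs₁ : T₁.IsSide s₁)
    (hcard : Fintype.card V₁ = Fintype.card V₂) (φ : G₁ ≃g G₂)
    {p : V₁} {v w u : V₂} (hp : StarSide s₁ p) (hD : IsDoubleBroom T₂ s₂ v w u) : False := by
  obtain ⟨x, hx⟩ := hM₂.exists_ncard_neighborSet_of_isDoubleBroom hD
  have hV : 4 ≤ Fintype.card V₂ := by
    obtain ⟨z, hz, hzu⟩ := hD.other u
    have hzv : v ≠ z := by
      rintro rfl
      exact hz rfl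
    have hzw : w ≠ z := by
      rintro rfl
      exact hz hD.side_w
    have : ({v, w, u, z} : Finset V₂).card = 4 := by
      rw [Finset.card_insert_of_notMem (by simp [hD.ne, hD.adj_vu.ne, hzv]),
        Finset.card_insert_of_notMem (by simp [hD.adj_wu.ne, hzw]), Finset.card_pair hzu.symm]
    rw [← this]
    exact Finset.card_le_univ _
  obtain ⟨x, rfl⟩ := φ.surjective x
  have := hM₁.le_ncard_neighborSet_of_starSide hT₁ hs₁ hp (hcard ▸ hV) x
  rw [φ.ncard_neighborSet] at hx
  omega

theorem nonempty_iso_of_isDoubleBroom (hM₁ : IsFlipModel T₁ G₁ s₁ π₁)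
    (hM₂ : IsFlipModel T₂ G₂ s₂ π₂) (hs₁ : T₁.IsSide s₁)
    (hs₂ : T₂.IsSide s₂) (hcard : Fintype.card V₁ = Fintype.card V₂) (φ : G₁ ≃g G₂)
    {v₁ w₁ u₁ : V₁} {v₂ w₂ u₂ : V₂} (hD₁ : IsDoubleBroom T₁ s₁ v₁ w₁ u₁)
    (hD₂ : IsDoubleBroom T₂ s₂ v₂ w₂ u₂) : Nonempty (T₁ ≃g T₂) := by
  have c1 := hD₁.card_eq hs₁
  have c2 := hD₂.card_eq hs₂
  have hor : ((IsDoubleBroom.privateNeighbors T₁ v₁ w₁).card =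
        (IsDoubleBroom.privateNeighbors T₂ v₂ w₂).card ∧
      (IsDoubleBroom.privateNeighbors T₁ w₁ v₁).card =
        (IsDoubleBroom.privateNeighbors T₂ w₂ v₂).card) ∨
      ((IsDoubleBroom.privateNeighbors T₁ v₁ w₁).card =
        (IsDoubleBroom.privateNeighbors T₂ w₂ v₂).card ∧
      (IsDoubleBroom.privateNeighbors T₁ w₁ v₁).card =
        (IsDoubleBroom.privateNeighbors T₂ v₂ w₂).card) := by
    by_cases hV : 5 ≤ Fintype.card V₁
    · refine eq_or_eq_of_two_pow_add_two_pow (by omega) ?_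
      rw [hM₁.two_pow_add_two_pow hD₁ hs₁ hV, hM₂.two_pow_add_two_pow hD₂ hs₂ (hcard ▸ hV)]
      congr 1
      refine Set.ncard_congr (fun x _ => φ x) (fun x hx => ?_) (fun x y _ _ h => φ.injective h)
        fun y hy => ?_
      · rw [Set.mem_ofPred_eq] at hx ⊢
        rwa [φ.ncard_neighborSet, ← hcard]
      · obtain ⟨x, rfl⟩ := φ.surjective y
        rw [Set.mem_ofPred_eq, φ.ncard_neighborSet, ← hcard] at hy
        exact ⟨x, hy, rfl⟩
    -- With at most four vertices the private counts sum to at most 1, so they agree up to order.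
    · omega
  rcases hor with ⟨ha, hb⟩ | ⟨ha, hb⟩
  · exact hD₁.nonempty_iso hs₁ hD₂ hs₂ ha hb
  · exact hD₁.nonempty_iso hs₁ hD₂.swap hs₂ ha hb

theorem nonempty_iso [Nontrivial V₁] [Nontrivial V₂] (hM₁ : IsFlipModel T₁ G₁ s₁ π₁)
    (hM₂ : IsFlipModel T₂ G₂ s₂ π₂) (hT₁ : T₁.IsTree) (hT₂ : T₂.IsTree) (hs₁ : T₁.IsSide s₁)
    (hs₂ : T₂.IsSide s₂) (φ : G₁ ≃g G₂) : Nonempty (T₁ ≃g T₂) := by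
  have hcard : Fintype.card V₁ = Fintype.card V₂ := by
    have h1 := hM₁.four_mul_card (hT₁.connected.isSide_surjective hs₁)
    have h2 := hM₂.four_mul_card (hT₂.connected.isSide_surjective hs₂)
    rw [Nat.card_congr φ.toEquiv, h2] at h1
    exact (Nat.pow_right_injective le_rfl h1).symm
  rcases hT₁.bigSides_or_starSide_or_isDoubleBroom hs₁ with hb₁ | ⟨p₁, hp₁⟩ | ⟨v₁, w₁, u₁, hD₁⟩ <;>
    rcases hT₂.bigSides_or_starSide_or_isDoubleBroom hs₂ with hb₂ | ⟨p₂, hp₂⟩ | ⟨v₂, w₂, u₂, hD₂⟩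
  · exact hM₁.nonempty_iso_of_bigSides hM₂ hT₁.connected hT₂.connected hs₁ hs₂ hb₁ hb₂ hcard φ
  · exact absurd hb₁ (hM₁.not_bigSides_of_iso hcard φ (hM₂.ncard_neighborSet_lt_of_starSide hp₂))
  · exact absurd hb₁ (hM₁.not_bigSides_of_iso hcard φ
      (hM₂.ncard_neighborSet_lt_of_isDoubleBroom hD₂))
  · exact absurd hb₂ (hM₂.not_bigSides_of_iso hcard.symm φ.symm
      (hM₁.ncard_neighborSet_lt_of_starSide hp₁))
  · exact hp₁.nonempty_iso hT₁.connected hT₂.connected hs₁ hs₂ hp₂ hcard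
  · exact (hM₁.not_starSide_of_iso hM₂ hT₁.connected hs₁ hcard φ hp₁ hD₂).elim
  · exact absurd hb₂ (hM₂.not_bigSides_of_iso hcard.symm φ.symm
      (hM₁.ncard_neighborSet_lt_of_isDoubleBroom hD₁))
  · exact (hM₂.not_starSide_of_iso hM₁ hT₂.connected hs₂ hcard.symm φ.symm hp₂ hD₁).elim
  · exact hM₁.nonempty_iso_of_isDoubleBroom hM₂ hs₁ hs₂ hcard φ hD₁ hD₂

theorem card_eq_two_of_natCard_eq_one [Nontrivial V₁] (hM₁ : IsFlipModel T₁ G₁ s₁ π₁)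
    (hT₁ : T₁.Connected) (hs₁ : T₁.IsSide s₁) (h : Nat.card W₁ = 1) : Fintype.card V₁ = 2 := by
  have h1 := hM₁.four_mul_card (hT₁.isSide_surjective hs₁)
  rw [h] at h1
  exact Nat.pow_right_injective le_rfl (h1.symm.trans (by norm_num))

end IsFlipModel

end Classification

end SimpleGraph

theorem mainTheorem4 {V₁ : Type*} {V₂ : Type*} [Fintype V₁] [DecidableEq V₁]
    [Fintype V₂] [DecidableEq V₂] (T₁ : SimpleGraph V₁) (T₂ : SimpleGraph V₂)
    (hT₁ : T₁.IsTree) (hT₂ : T₂.IsTree)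
    (h₁₂ : ¬ (Fintype.card V₁ = 1 ∧ Fintype.card V₂ = 2))
    (h₂₁ : ¬ (Fintype.card V₁ = 2 ∧ Fintype.card V₂ = 1)) :
    Nonempty (T₁.bellColoringGraph 3 ≃g T₂.bellColoringGraph 3) ↔ Nonempty (T₁ ≃g T₂) := by
  refine ⟨?_, fun ⟨e⟩ => ⟨e.bellColoringGraph 3⟩⟩
  rintro ⟨φ⟩
  obtain ⟨s₁, hs₁⟩ := hT₁.exists_isSide
  obtain ⟨s₂, hs₂⟩ := hT₂.exists_isSide
  obtain ⟨π₁, hM₁⟩ := hT₁.exists_isFlipModel hs₁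
  obtain ⟨π₂, hM₂⟩ := hT₂.exists_isFlipModel hs₂
  have := hT₁.connected.nonempty
  have := hT₂.connected.nonempty
  have hW := Nat.card_congr φ.toEquiv
  rcases subsingleton_or_nontrivial V₁ with h1 | h1 <;>
    rcases subsingleton_or_nontrivial V₂ with h2 | h2
  · refine ⟨⟨Fintype.equivOfCardEq (by rw [SimpleGraph.card_eq_one_of_subsingleton V₁,
      SimpleGraph.card_eq_one_of_subsingleton V₂]), fun {a b} => ?_⟩⟩
    rw [Subsingleton.elim a b]
    simp
  · rw [hM₁.natCard_eq_one] at hW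
    exact absurd ⟨SimpleGraph.card_eq_one_of_subsingleton V₁,
      hM₂.card_eq_two_of_natCard_eq_one hT₂.connected hs₂ hW.symm⟩ h₁₂
  · rw [hM₂.natCard_eq_one] at hW
    exact absurd ⟨hM₁.card_eq_two_of_natCard_eq_one hT₁.connected hs₁ hW,
      SimpleGraph.card_eq_one_of_subsingleton V₂⟩ h₂₁
  · exact hM₁.nonempty_iso hM₂ hT₁ hT₂ hs₁ hs₂ φ
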